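/- Let $0<\beta<\alpha$ and $M>0$. Then there is a constant $N=N(\alpha,\beta,M)>0$, depending only on $\alpha$, $\beta$ and $M$, such that the following holds for every $d\ge 2$ and every domain (non-empty connected open set) $\Omega\subsetneq\mathbb{R}^d$. Suppose that $\Omega$ satisfies the local harmonic measure decay property $\mathbf{LHMD}(\alpha)$ with constant $M$, i.e. $$ w\big(x,\Omega\cap B_r(p),\Omega\cap\partial B_r(p)\big)\le M\Big(\frac{|x-p|}{r}\Big)^{\alpha}\qquad\text{for all }p\in\partial\Omega,\ r>0,\ x\in\Omega\cap B_r(p). $$ Then there is a function $\phi$ on $\Omega$ that is superharmonic, i.e. $\phi$ is locally integrable in $\Omega$ and $\int_\Omega\phi\,\Delta\zeta\,dx\le 0$ for every nonnegative $\zeta\in C_c^\infty(\Omega)$, and that satisfies $$ N^{-1}\rho(x)^\beta\le\phi(x)\le N\rho(x)^\beta\qquad\text{for all }x\in\Omega,\quad\text{where }\rho(x):=\mathrm{dist}(x,\partial\Omega). $$ Here, for a bounded open set $U\subset\mathbb{R}^d$ and a Borel set $E\subset\partial U$, $w(\,\cdot\,,U,E)$ is the harmonic measure of $E$ over $U$,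 that is, the Perron–Wiener–Brelot solution with boundary data $1_E$: $w(x,U,E)$ is the infimum of $\varphi(x)$ over all classical superharmonic functions $\varphi$ on $U$ with $\liminf_{y\to z,\,y\in U}\varphi(y)\ge 1_E(z)$ for all $z\in\partial U$. A classical superharmonic function on $U$ is a lower semicontinuous function $\varphi:U\to(-\infty,+\infty]$ that is not identically $+\infty$ on any connected component of $U$ and satisfies $\varphi(x)\ge|B_r(x)|^{-1}\int_{B_r(x)}\varphi(y)\,dy$ whenever $x\in U$, $r>0$ and $\overline{B}_r(x)\subset U$. -/

import Mathlib

open MeasureTheory Set Filter Topology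
open scoped ENNReal ContDiff

/-- A real function `φ` is superharmonic on the open set `Ω` in the sense of distributions: it is
locally integrable in `Ω` and `∫_Ω φ Δζ ≤ 0` for every nonnegative `ζ ∈ C_c^∞(Ω)`. -/
def IsSuperharmonicOn {d : ℕ} (φ : EuclideanSpace ℝ (Fin d) → ℝ)
    (Ω : Set (EuclideanSpace ℝ (Fin d))) : Prop :=
  LocallyIntegrableOn φ Ω volume ∧
    ∀ ζ : EuclideanSpace ℝ (Fin d) → ℝ,
      ContDiff ℝ ∞ ζ → HasCompactSupport ζ → tsupport ζ ⊆ Ω → (∀ x, 0 ≤ ζ x) →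
        ∫ x in Ω, φ x * Laplacian.laplacian ζ x ≤ 0

/-- The mean value `|B|⁻¹ ∫_B φ` of an extended-real function over the ball `B = B_r(x)`, as the
mean of the positive part minus the mean of the negative part. (For a function that is lower
semicontinuous and `> -∞` on the closed ball the second mean is finite.) -/
noncomputable def ballMean {d : ℕ} (φ : EuclideanSpace ℝ (Fin d) → EReal)
    (x : EuclideanSpace ℝ (Fin d)) (r : ℝ) : EReal :=
  ((⨍⁻ y in Metric.ball x r, (φ y).toENNReal ∂volume : ℝ≥0∞) : EReal) -
    ((⨍⁻ y in Metric.ball x r, (-φ y).toENNReal ∂volume : ℝ≥0∞) : EReal)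

/-- Classical superharmonic functions `φ : Ω → (-∞, +∞]` on an open set `Ω`; only the values of
`φ` on `Ω` matter. -/
structure IsClassicalSuperharmonicOn {d : ℕ} (φ : EuclideanSpace ℝ (Fin d) → EReal)
    (Ω : Set (EuclideanSpace ℝ (Fin d))) : Prop where
  ne_bot : ∀ x ∈ Ω, φ x ≠ ⊥
  lowerSemicontinuousOn : LowerSemicontinuousOn φ Ω
  ballMean_le : ∀ x ∈ Ω, ∀ r : ℝ, 0 < r → Metric.closedBall x r ⊆ Ω → ballMean φ x r ≤ φ x
  /-- `φ` is not identically `+∞` on any connected component of `Ω`. -/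
  ne_top : ∀ x ∈ Ω, ∃ y ∈ connectedComponentIn Ω x, φ y ≠ ⊤

/-- The Perron–Wiener–Brelot solution of `Δu = 0` in the bounded open set `U`, `u = F` on `∂U`:
the pointwise infimum of all classical superharmonic functions `φ` on `U` such that
`liminf_{y → z, y ∈ U} φ(y) ≥ F(z)` for all `z ∈ ∂U`. -/
noncomputable def pwbSolution {d : ℕ} (U : Set (EuclideanSpace ℝ (Fin d)))
    (F : EuclideanSpace ℝ (Fin d) → ℝ) (x : EuclideanSpace ℝ (Fin d)) : EReal :=
  ⨅ φ ∈ {φ : EuclideanSpace ℝ (Fin d) → EReal | IsClassicalSuperharmonicOn φ U ∧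
      ∀ z ∈ frontier U, (F z : EReal) ≤ liminf φ (𝓝[U] z)}, φ x

/-- The harmonic measure `w(x, U, A)` of `A ⊆ ∂U` over the bounded open set `U`. -/
noncomputable def harmonicMeasure {d : ℕ} (x : EuclideanSpace ℝ (Fin d))
    (U A : Set (EuclideanSpace ℝ (Fin d))) : EReal :=
  pwbSolution U (A.indicator fun _ => 1) x

/-- The local harmonic measure decay property of `Ω` with exponent `α` and constant `M`:
`w(x, Ω ∩ B_r(p), Ω ∩ ∂B_r(p)) ≤ M (|x - p| / r)^α` for all `p ∈ ∂Ω`, `r > 0` and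
`x ∈ Ω ∩ B_r(p)`. -/
def LHMDWith {d : ℕ} (Ω : Set (EuclideanSpace ℝ (Fin d))) (α M : ℝ) : Prop :=
  ∀ p ∈ frontier Ω, ∀ r : ℝ, 0 < r → ∀ x ∈ Ω ∩ Metric.ball p r,
    harmonicMeasure x (Ω ∩ Metric.ball p r) (Ω ∩ Metric.sphere p r) ≤
      ((M * (dist x p / r) ^ α : ℝ) : EReal)

/-!
Truncating the competitors in the Perron infimum that defines `w(·, Ω ∩ B_r(p), Ω ∩ ∂B_r(p))`, and
using the minimum principle (`IsSupermeanOn.nonneg`), one obtains a family of *admissible*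
functions `v` with values in `[0, 1]` on `Ω ∩ B_r(p)`, which dominate their means over balls and
tend to `1` at `Ω ∩ ∂B_r(p)`. The superharmonic function is the lower semicontinuous envelope of

  `Φ(y) = inf r ^ β * (v y + ε)`,

the infimum being over all `p ∈ ∂Ω`, all `r > |y - p|` and all admissible `v` (`admissibleInf`).

The bounds are immediate: `r ≥ dist(y, ∂Ω)` and `v ≥ 0` give `Φ ≥ ε ρ ^ β`, and `v = 1` on the ball
of radius `2 ρ(y)` about a nearest boundary point gives `Φ ≤ (2 ρ) ^ β (1 + ε)`.

The members of the family live on different sets, so an infimum of them dominates its means only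
if each member, where it is close to the sphere bounding its domain, is beaten by another one.
This is where `β < α` enters: with `A` large and `ε = A ^ (-β) / 2`, the decay property yields, for
`y ∈ B_r(p)`, an admissible function for the radius `A r` about a boundary point nearest to `y`
with `(A r) ^ β (v' y + ε) ≤ 3/4 r ^ β`. On the other hand an admissible `v` for the radius `r` is at
least `3/4` at all points whose distance to `∂B_r(p)` is a small fraction, depending only on `d`, of
their distance to `∂Ω` (`IsAdmissible.three_quarters_le`, by comparison with an explicit harmonic
quadratic polynomial). Hence the means of the envelope over `B_σ(y)` are at most `Φ(y)` as soon as
`8 (d + 1) σ ≤ ρ(y)` (`setLIntegral_lscEnvelope_le_admissibleInf`). The size of the ball being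
locally uniform in the family, the same holds with the envelope on the right-hand side. No
countable subfamily has to be selected, because the envelope is automatically measurable.

Finally, a locally integrable function dominating its means over small balls is superharmonic in
the sense of distributions (`isSuperharmonicOn_of_integral_ball_le`): averaging over balls is
symmetric, and the mean of `ζ` over `B_σ(x)` minus `ζ x` is `c (Δζ x + O(σ))` with a constant
`c > 0` depending on `σ` and `d`.
-/

/-! ### Quadratic moments of balls -/

/-- The quadratic moment `∫_{B_σ(0)} |y|² dy` of the ball of radius `σ`. -/
noncomputable def ballSecondMoment (d : ℕ) (σ : ℝ) : ℝ :=
  ∫ y in Metric.ball (0 : EuclideanSpace ℝ (Fin d)) σ, ‖y‖ ^ 2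

theorem Continuous.integrableOn_ball {d : ℕ} {g : EuclideanSpace ℝ (Fin d) → ℝ}
    (hg : Continuous g) (x : EuclideanSpace ℝ (Fin d)) (σ : ℝ) :
    IntegrableOn g (Metric.ball x σ) volume :=
  (hg.continuousOn.integrableOn_compact (isCompact_closedBall x σ)).mono_set
    Metric.ball_subset_closedBall

theorem integral_ball_comp_linearIsometryEquiv {d : ℕ} (σ : ℝ)
    (L : EuclideanSpace ℝ (Fin d) ≃ₗᵢ[ℝ] EuclideanSpace ℝ (Fin d))
    (g : EuclideanSpace ℝ (Fin d) → ℝ) :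
    ∫ y in Metric.ball 0 σ, g (L y) = ∫ y in Metric.ball 0 σ, g y := by
  have h := L.measurePreserving.setIntegral_preimage_emb
    L.toHomeomorph.measurableEmbedding g (Metric.ball 0 σ)
  have h2 : L ⁻¹' Metric.ball 0 σ = Metric.ball 0 σ := by
    ext y; simp
  rwa [h2] at h

theorem integral_ball_coord_mul {d : ℕ} (σ : ℝ) {i j : Fin d} (hij : i ≠ j) :
    ∫ y in Metric.ball (0 : EuclideanSpace ℝ (Fin d)) σ, y i * y j = 0 := by
  have h := integral_ball_comp_linearIsometryEquiv σ
    (LinearIsometryEquiv.piLpCongrRight 2 (fun k : Fin d =>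
      if k = i then LinearIsometryEquiv.neg ℝ else LinearIsometryEquiv.refl ℝ ℝ))
    (fun y : EuclideanSpace ℝ (Fin d) => y i * y j)
  simp [hij.symm, integral_neg] at h
  linarith

theorem integral_ball_coord_sq_eq {d : ℕ} (σ : ℝ) (i j : Fin d) :
    ∫ y in Metric.ball (0 : EuclideanSpace ℝ (Fin d)) σ, y i ^ 2 =
      ∫ y in Metric.ball (0 : EuclideanSpace ℝ (Fin d)) σ, y j ^ 2 := by
  have h := integral_ball_comp_linearIsometryEquiv σ
    (LinearIsometryEquiv.piLpCongrLeft 2 ℝ ℝ (Equiv.swap i j))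
    (fun y : EuclideanSpace ℝ (Fin d) => y j ^ 2)
  simpa [LinearIsometryEquiv.piLpCongrLeft_apply, Equiv.piCongrLeft'] using h

theorem mul_integral_ball_coord_sq {d : ℕ} (σ : ℝ) (i : Fin d) :
    d * ∫ y in Metric.ball (0 : EuclideanSpace ℝ (Fin d)) σ, y i ^ 2 =
      ballSecondMoment d σ := by
  have h : ballSecondMoment d σ =
      ∑ j : Fin d, ∫ y in Metric.ball (0 : EuclideanSpace ℝ (Fin d)) σ, y j ^ 2 := by
    rw [← integral_finsetSum]
    · simp [ballSecondMoment, EuclideanSpace.norm_sq_eq]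
    · intro j _
      exact Continuous.integrableOn_ball (by fun_prop) _ _
  rw [h, Finset.sum_congr rfl (fun j _ => integral_ball_coord_sq_eq σ j i)]
  simp

/-- By the symmetries of the ball, a quadratic form integrates over it to a multiple of its
trace. -/
theorem mul_integral_ball_bilin {d : ℕ} (σ : ℝ)
    (B : EuclideanSpace ℝ (Fin d) →L[ℝ] EuclideanSpace ℝ (Fin d) →L[ℝ] ℝ) :
    d * ∫ y in Metric.ball (0 : EuclideanSpace ℝ (Fin d)) σ, B y y =
      ballSecondMoment d σ * ∑ i, B (EuclideanSpace.basisFun (Fin d) ℝ i)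
        (EuclideanSpace.basisFun (Fin d) ℝ i) := by
  set e := EuclideanSpace.basisFun (Fin d) ℝ
  have h1 : ∀ y : EuclideanSpace ℝ (Fin d),
      B y y = ∑ i, ∑ j, B (e j) (e i) * (y i * y j) := by
    intro y
    have hy : y = ∑ i, y i • e i := by
      simpa [e] using (e.sum_repr y).symm
    conv_lhs => rw [hy]
    simp only [map_sum, map_smul, sum_apply, smul_apply,
      smul_eq_mul]
    refine Finset.sum_congr rfl fun i _ => ?_
    rw [Finset.mul_sum]
    refine Finset.sum_congr rfl fun j _ => ?_
    ring
  rw [integral_congr_ae (Eventually.of_forall h1)]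
  rw [integral_finsetSum _ fun i _ => Continuous.integrableOn_ball (by fun_prop) _ _,
    Finset.mul_sum, Finset.mul_sum]
  refine Finset.sum_congr rfl fun i _ => ?_
  rw [integral_finsetSum _ fun j _ => Continuous.integrableOn_ball (by fun_prop) _ _,
    Finset.sum_eq_single i]
  · rw [integral_const_mul, ← mul_integral_ball_coord_sq σ i]
    simp_rw [← pow_two]
    ring
  · intro j _ hj
    rw [integral_const_mul, integral_ball_coord_mul σ hj.symm, mul_zero]
  · simp

theorem integral_ball_clm {d : ℕ} (σ : ℝ) (l : EuclideanSpace ℝ (Fin d) →L[ℝ] ℝ) :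
    ∫ y in Metric.ball (0 : EuclideanSpace ℝ (Fin d)) σ, l y = 0 := by
  have h := integral_ball_comp_linearIsometryEquiv σ (LinearIsometryEquiv.neg ℝ) l
  simp [integral_neg] at h
  linarith

theorem ballSecondMoment_pos {d : ℕ} (hd : 0 < d) {σ : ℝ} (hσ : 0 < σ) :
    0 < ballSecondMoment d σ := by
  have : Nonempty (Fin d) := ⟨⟨0, hd⟩⟩
  have hc : Continuous fun y : EuclideanSpace ℝ (Fin d) => ‖y‖ ^ 2 := by fun_prop
  rw [ballSecondMoment, setIntegral_pos_iff_support_of_nonneg_ae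
    (Eventually.of_forall fun y => by positivity) (hc.integrableOn_ball _ _)]
  have : Function.support (fun y : EuclideanSpace ℝ (Fin d) => ‖y‖ ^ 2) = {0}ᶜ := by
    ext y; simp
  rw [this, inter_comm, ← sdiff_eq, measure_sdiff_null (by simp)]
  exact Metric.measure_ball_pos _ _ hσ

theorem setIntegral_ball_add {d : ℕ} (g : EuclideanSpace ℝ (Fin d) → ℝ)
    (x : EuclideanSpace ℝ (Fin d)) (σ : ℝ) :
    ∫ y in Metric.ball 0 σ, g (x + y) = ∫ y in Metric.ball x σ, g y := by
  have h := (measurePreserving_add_left volume x).setIntegral_preimage_emb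
    (measurableEmbedding_addLeft x) g (Metric.ball x σ)
  rwa [preimage_add_ball, sub_self] at h

/-! ### From the mean value inequality to distributional superharmonicity -/

/-- Second order Taylor formula with a Lipschitz bound on the second derivative. -/
theorem abs_taylor_two_le {d : ℕ} {ζ : EuclideanSpace ℝ (Fin d) → ℝ}
    {G : EuclideanSpace ℝ (Fin d) → EuclideanSpace ℝ (Fin d) →L[ℝ] ℝ}
    {H : EuclideanSpace ℝ (Fin d) →
      EuclideanSpace ℝ (Fin d) →L[ℝ] EuclideanSpace ℝ (Fin d) →L[ℝ] ℝ}
    (hζ : ∀ x, HasFDerivAt ζ (G x) x) (hG : ∀ x, HasFDerivAt G (H x) x)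
    (hsym : ∀ x a b, H x a b = H x b a) {K : NNReal} (hK : LipschitzWith K H)
    (x y : EuclideanSpace ℝ (Fin d)) :
    |ζ (x + y) - ζ x - G x y - (1 / 2) * H x y y| ≤ K * ‖y‖ ^ 3 := by
  have h1 : ∀ y, ‖G (x + y) - G x - H x y‖ ≤ K * ‖y‖ * ‖y‖ := by
    intro y
    have := (convex_closedBall x ‖y‖).norm_image_sub_le_of_norm_hasFDerivWithin_le'
      (f := G) (f' := H) (φ := H x) (C := K * ‖y‖) (x := x) (y := x + y)
      (fun z _ => (hG z).hasFDerivWithinAt)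
      (fun z hz => by
        have := hK.dist_le_mul z x
        rw [dist_eq_norm] at this
        exact this.trans (by gcongr; exact hz))
      (by simp) (by simp)
    simpa using this
  have hderiv : ∀ z, HasFDerivAt
      (fun y => ζ (x + y) - G x y - (1 / 2) * H x y y) (G (x + z) - G x - H x z) z := by
    intro z
    have a1 : HasFDerivAt (fun y => ζ (x + y)) (G (x + z)) z :=
      (hasFDerivAt_comp_add_left x).2 (hζ _)
    have a3 : HasFDerivAt (fun y => H x y y)
        ((H x z).comp (ContinuousLinearMap.id ℝ _) + (H x).flip z) z :=
      ((H x).hasFDerivAt (x := z)).clm_apply (hasFDerivAt_id z)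
    have := (a1.sub ((G x).hasFDerivAt (x := z))).sub (a3.const_mul (1 / 2))
    refine this.congr_fderiv ?_
    ext w
    simp [hsym x w z]
    ring
  have := (convex_closedBall (0 : EuclideanSpace ℝ (Fin d))
      ‖y‖).norm_image_sub_le_of_norm_hasFDerivWithin_le
      (x := 0) (y := y) (C := K * ‖y‖ * ‖y‖)
      (fun z _ => (hderiv z).hasFDerivWithinAt)
      (fun z hz => (h1 z).trans (by
        have : ‖z‖ ≤ ‖y‖ := by simpa using hz
        gcongr))
      (by simp) (by simp)
  simp only [map_zero, add_zero, sub_zero, mul_zero, Real.norm_eq_abs] at this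
  convert this using 1
  · congr 1; ring
  · ring

theorem exists_taylor_two_bound {d : ℕ} {ζ : EuclideanSpace ℝ (Fin d) → ℝ}
    (hζ : ContDiff ℝ ∞ ζ) (hc : HasCompactSupport ζ) :
    ∃ C : ℝ, 0 ≤ C ∧ ∀ x y : EuclideanSpace ℝ (Fin d),
      |ζ (x + y) - ζ x - fderiv ℝ ζ x y - (1 / 2) * fderiv ℝ (fderiv ℝ ζ) x y y| ≤
        C * ‖y‖ ^ 3 := by
  have hG : ContDiff ℝ ∞ (fderiv ℝ ζ) := hζ.fderiv_right (by simp)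
  have hH : ContDiff ℝ 1 (fderiv ℝ (fderiv ℝ ζ)) := hG.fderiv_right (by norm_cast)
  have hsym : ∀ x a b, fderiv ℝ (fderiv ℝ ζ) x a b = fderiv ℝ (fderiv ℝ ζ) x b a := by
    intro x a b
    have h2 : (2 : WithTop ℕ∞) ≤ ((⊤ : ℕ∞) : WithTop ℕ∞) := by norm_cast
    exact (hζ.contDiffAt (x := x)).isSymmSndFDerivAt (by simpa using h2) a b
  have hK : ∃ K, LipschitzWith K (fderiv ℝ (fderiv ℝ ζ)) :=
    hH.lipschitzWith_of_hasCompactSupport ((hc.fderiv ℝ).fderiv ℝ) (by simp)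
  obtain ⟨K, hK⟩ := hK
  exact ⟨K, K.2, abs_taylor_two_le
    (fun x => (hζ.differentiable (by simp) x).hasFDerivAt)
    (fun x => (hG.differentiable (by simp) x).hasFDerivAt) hsym hK⟩

theorem laplacian_eq_sum_fderiv {d : ℕ} (ζ : EuclideanSpace ℝ (Fin d) → ℝ)
    (x : EuclideanSpace ℝ (Fin d)) :
    Laplacian.laplacian ζ x = ∑ i, fderiv ℝ (fderiv ℝ ζ) x
      (EuclideanSpace.basisFun (Fin d) ℝ i) (EuclideanSpace.basisFun (Fin d) ℝ i) := by
  rw [InnerProductSpace.laplacian_eq_iteratedFDeriv_orthonormalBasis ζ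
    (EuclideanSpace.basisFun (Fin d) ℝ)]
  simp [iteratedFDeriv_two_apply]

/-- The integral of `ζ (x + ·) - ζ x` over `B_σ(0)` is `Δζ x` times `ballSecondMoment d σ / (2 d)`,
up to an error that is smaller by a factor `σ`, uniformly in `x`. -/
theorem exists_integral_ball_sub_laplacian_bound {d : ℕ}
    {ζ : EuclideanSpace ℝ (Fin d) → ℝ} (hζ : ContDiff ℝ ∞ ζ) (hc : HasCompactSupport ζ) :
    ∃ C : ℝ, 0 ≤ C ∧ ∀ (x : EuclideanSpace ℝ (Fin d)) (σ : ℝ), 0 < σ →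
      |d * (∫ y in Metric.ball 0 σ, (ζ (x + y) - ζ x)) -
          ballSecondMoment d σ / 2 * Laplacian.laplacian ζ x| ≤
        C * σ * ballSecondMoment d σ := by
  obtain ⟨C, hC, h⟩ := exists_taylor_two_bound hζ hc
  refine ⟨d * C, by positivity, fun x σ hσ => ?_⟩
  have hcont := hζ.continuous
  have e1 : d * (∫ y in Metric.ball 0 σ, (ζ (x + y) - ζ x)) -
      ballSecondMoment d σ / 2 * Laplacian.laplacian ζ x = d * ∫ y in Metric.ball 0 σ,
      (ζ (x + y) - ζ x - fderiv ℝ ζ x y - (1 / 2) * fderiv ℝ (fderiv ℝ ζ) x y y) := by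
    have hi1 : IntegrableOn (fun y => ζ (x + y) - ζ x) (Metric.ball 0 σ) volume :=
      Continuous.integrableOn_ball (by fun_prop) _ _
    have hi2 : IntegrableOn (fun y => fderiv ℝ ζ x y) (Metric.ball 0 σ) volume :=
      Continuous.integrableOn_ball (by fun_prop) _ _
    have hi4 : IntegrableOn (fun y => ζ (x + y) - ζ x - fderiv ℝ ζ x y) (Metric.ball 0 σ) volume :=
      hi1.sub hi2
    have hi3 : IntegrableOn (fun y => (1 / 2) * fderiv ℝ (fderiv ℝ ζ) x y y)
        (Metric.ball 0 σ) volume :=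
      Continuous.integrableOn_ball (by fun_prop) _ _
    rw [integral_sub hi4 hi3, integral_sub hi1 hi2, integral_ball_clm,
      integral_const_mul, laplacian_eq_sum_fderiv, sub_zero, mul_sub]
    have := mul_integral_ball_bilin σ (fderiv ℝ (fderiv ℝ ζ) x)
    linear_combination (1 / 2) * this
  rw [e1, abs_mul, Nat.abs_cast, mul_assoc, mul_assoc]
  refine mul_le_mul_of_nonneg_left ?_ (by positivity)
  rw [ballSecondMoment, ← integral_const_mul, ← integral_const_mul, ← Real.norm_eq_abs]
  refine norm_integral_le_of_norm_le (Continuous.integrableOn_ball (by fun_prop) _ _) ?_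
  refine (ae_restrict_iff' measurableSet_ball).2 (Eventually.of_forall fun y hy => ?_)
  refine (h x y).trans (mul_le_mul_of_nonneg_left ?_ hC)
  have : ‖y‖ < σ := by simpa using hy
  nlinarith [sq_nonneg ‖y‖]

theorem laplacian_eq_zero_of_notMem_tsupport {d : ℕ} {ζ : EuclideanSpace ℝ (Fin d) → ℝ}
    {x : EuclideanSpace ℝ (Fin d)} (hx : x ∉ tsupport ζ) : Laplacian.laplacian ζ x = 0 := by
  have h : fderiv ℝ (fderiv ℝ ζ) x = 0 := image_eq_zero_of_notMem_tsupport fun hx' =>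
    hx (tsupport_fderiv_subset ℝ (tsupport_fderiv_subset ℝ hx'))
  simp [laplacian_eq_sum_fderiv, h]

theorem continuous_laplacian {d : ℕ} {ζ : EuclideanSpace ℝ (Fin d) → ℝ}
    (hζ : ContDiff ℝ ∞ ζ) : Continuous (Laplacian.laplacian ζ) := by
  have hG : ContDiff ℝ ∞ (fderiv ℝ ζ) := hζ.fderiv_right (by simp)
  have hH : Continuous (fderiv ℝ (fderiv ℝ ζ)) := hG.continuous_fderiv (by simp)
  have : Laplacian.laplacian ζ = fun x => ∑ i, fderiv ℝ (fderiv ℝ ζ) x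
      (EuclideanSpace.basisFun (Fin d) ℝ i) (EuclideanSpace.basisFun (Fin d) ℝ i) :=
    funext (laplacian_eq_sum_fderiv ζ)
  rw [this]
  fun_prop

/-- Averaging over balls is a symmetric operator. -/
theorem integral_mul_integral_ball_comm {d : ℕ} {F g : EuclideanSpace ℝ (Fin d) → ℝ}
    (hF : Integrable F) (hg : Integrable g) (σ : ℝ) :
    Integrable (fun x => F x * ∫ y in Metric.ball x σ, g y) ∧
      Integrable (fun y => (∫ x in Metric.ball y σ, F x) * g y) ∧
      ∫ x, F x * ∫ y in Metric.ball x σ, g y = ∫ y, (∫ x in Metric.ball y σ, F x) * g y := by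
  set T : Set (EuclideanSpace ℝ (Fin d) × EuclideanSpace ℝ (Fin d)) := {p | dist p.1 p.2 < σ}
  have hT : MeasurableSet T := (isOpen_lt (by fun_prop) continuous_const).measurableSet
  have hi : Integrable (Function.uncurry fun x y => T.indicator (fun p => F p.1 * g p.2) (x, y))
      (volume.prod volume) := (hF.mul_prod hg).indicator hT
  have e1 : ∀ x, ∫ y, T.indicator (fun p => F p.1 * g p.2) (x, y) =
      F x * ∫ y in Metric.ball x σ, g y := by
    intro x
    rw [← integral_const_mul, ← integral_indicator measurableSet_ball]
    refine integral_congr_ae (Eventually.of_forall fun y => ?_)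
    by_cases h : dist x y < σ
    · simp [indicator_of_mem (show (x, y) ∈ T from h),
        indicator_of_mem (show y ∈ Metric.ball x σ from (dist_comm y x).trans_lt h)]
    · simp [indicator_of_notMem (show (x, y) ∉ T from h),
        indicator_of_notMem (show y ∉ Metric.ball x σ from fun h' => h (Metric.mem_ball'.1 h'))]
  have e2 : ∀ y, ∫ x, T.indicator (fun p => F p.1 * g p.2) (x, y) =
      (∫ x in Metric.ball y σ, F x) * g y := by
    intro y
    rw [← integral_mul_const, ← integral_indicator measurableSet_ball]
    refine integral_congr_ae (Eventually.of_forall fun x => ?_)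
    by_cases h : dist x y < σ
    · simp [indicator_of_mem (show (x, y) ∈ T from h),
        indicator_of_mem (show x ∈ Metric.ball y σ from h)]
    · simp [indicator_of_notMem (show (x, y) ∉ T from h),
        indicator_of_notMem (show x ∉ Metric.ball y σ from h)]
  have h1 := hi.integral_prod_left
  have h2 := hi.integral_prod_right
  have h3 := integral_integral_swap hi
  simp only [Function.uncurry_apply_pair, e1, e2] at h1 h2 h3
  exact ⟨h1, h2, h3⟩

theorem integral_mul_laplacian_nonpos {d : ℕ} (hd : 0 < d) {F ζ : EuclideanSpace ℝ (Fin d) → ℝ}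
    (hF : Integrable F) (hζ : ContDiff ℝ ∞ ζ) (hc : HasCompactSupport ζ) (h0 : ∀ x, 0 ≤ ζ x)
    {δ : ℝ} (hδ : 0 < δ) (h : ∀ x ∈ tsupport ζ, ∀ σ, 0 < σ → σ < δ →
      ∫ y in Metric.ball x σ, F y ≤
        volume.real (Metric.ball (0 : EuclideanSpace ℝ (Fin d)) σ) * F x) :
    ∫ x, F x * Laplacian.laplacian ζ x ≤ 0 := by
  obtain ⟨C, hC, hb⟩ := exists_integral_ball_sub_laplacian_bound hζ hc
  have hζi : Integrable ζ := hζ.continuous.integrable_of_hasCompactSupport hc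
  have bdd : ∀ g : EuclideanSpace ℝ (Fin d) → ℝ, Continuous g → tsupport g ⊆ tsupport ζ →
      Integrable fun x => F x * g x := by
    intro g hg hs
    obtain ⟨c, hc'⟩ := hg.bounded_above_of_compact_support
      (hc.of_isClosed_subset (isClosed_tsupport g) hs)
    exact hF.mul_bdd hg.aestronglyMeasurable (Eventually.of_forall hc')
  have hΔi : Integrable fun x => F x * Laplacian.laplacian ζ x := by
    refine bdd _ (continuous_laplacian hζ) (closure_minimal (fun x hx => ?_) (isClosed_tsupport ζ))
    by_contra hx'
    exact hx (laplacian_eq_zero_of_notMem_tsupport hx')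
  have hFζ : Integrable fun x => F x * ζ x := bdd ζ hζ.continuous subset_rfl
  have key : ∀ σ, 0 < σ → σ < δ → ∫ x, F x * Laplacian.laplacian ζ x ≤
      2 * C * σ * ∫ x, |F x| := by
    intro σ hσ hσδ
    set v := volume.real (Metric.ball (0 : EuclideanSpace ℝ (Fin d)) σ)
    have hS := ballSecondMoment_pos hd hσ
    set S := ballSecondMoment d σ
    obtain ⟨i1, i2, e⟩ := integral_mul_integral_ball_comm hF hζi σ
    have hA : ∫ x, F x * ∫ y in Metric.ball x σ, ζ y ≤ ∫ x, v * (F x * ζ x) := by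
      rw [e]
      refine integral_mono i2 (hFζ.const_mul v) fun x => ?_
      by_cases hx : x ∈ tsupport ζ
      · have := mul_le_mul_of_nonneg_right (h x hx σ hσ hσδ) (h0 x)
        simpa only [mul_assoc] using this
      · simp [image_eq_zero_of_notMem_tsupport hx]
    have hB : ∫ x, (S / 2 * (F x * Laplacian.laplacian ζ x) - C * σ * S * |F x|) ≤
        ∫ x, d * (F x * (∫ y in Metric.ball x σ, ζ y) - v * (F x * ζ x)) := by
      refine integral_mono ((hΔi.const_mul _).sub (hF.abs.const_mul _))
        ((i1.sub (hFζ.const_mul v)).const_mul _) fun x => ?_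
      have h1 := hb x σ hσ
      have h2 : ∫ y in Metric.ball 0 σ, (ζ (x + y) - ζ x) =
          (∫ y in Metric.ball x σ, ζ y) - v * ζ x := by
        have := hζ.continuous
        rw [integral_sub (Continuous.integrableOn_ball (by fun_prop) _ _)
          (Continuous.integrableOn_ball (by fun_prop) _ _), setIntegral_ball_add]
        simp [v]
      rw [h2] at h1
      have h3 := mul_le_mul_of_nonneg_left h1 (abs_nonneg (F x))
      rw [← abs_mul] at h3
      have h4 := (abs_le.1 h3).1
      simp only
      linear_combination h4
    rw [integral_sub (hΔi.const_mul _) (hF.abs.const_mul _), integral_const_mul,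
      integral_const_mul, integral_const_mul, integral_sub i1 (hFζ.const_mul v)] at hB
    have hd' : (0 : ℝ) ≤ d := Nat.cast_nonneg d
    have hneg := mul_nonpos_of_nonneg_of_nonpos hd' (sub_nonpos.2 hA)
    have := hB.trans hneg
    have h5 : S * (∫ x, F x * Laplacian.laplacian ζ x) ≤ S * (2 * C * σ * ∫ x, |F x|) := by
      linear_combination 2 * this
    exact le_of_mul_le_mul_left h5 hS
  have ht : Tendsto (fun σ : ℝ => 2 * C * σ * ∫ x, |F x|) (𝓝[>] 0) (𝓝 0) := by
    have : Continuous fun σ : ℝ => 2 * C * σ * ∫ x, |F x| := by fun_prop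
    simpa using (this.tendsto 0).mono_left nhdsWithin_le_nhds
  refine ge_of_tendsto ht ?_
  filter_upwards [Ioo_mem_nhdsGT hδ] with σ hσ using key σ hσ.1 hσ.2

/-- A locally integrable function that dominates its means over small balls, uniformly on compact
sets, is superharmonic in the sense of distributions. -/
theorem isSuperharmonicOn_of_integral_ball_le {d : ℕ} (hd : 0 < d)
    {f : EuclideanSpace ℝ (Fin d) → ℝ} {Ω : Set (EuclideanSpace ℝ (Fin d))} (hΩ : IsOpen Ω)
    (hf : LocallyIntegrableOn f Ω volume)
    (h : ∀ K ⊆ Ω, IsCompact K → ∃ δ : ℝ, 0 < δ ∧ ∀ x ∈ K, ∀ σ, 0 < σ → σ < δ →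
      ∫ y in Metric.ball x σ, f y ≤
        volume.real (Metric.ball (0 : EuclideanSpace ℝ (Fin d)) σ) * f x) :
    IsSuperharmonicOn f Ω := by
  refine ⟨hf, fun ζ hζ hc hsub h0 => ?_⟩
  obtain ⟨ε, hε, hεΩ⟩ := hc.isCompact.exists_cthickening_subset_open hΩ hsub
  set K := Metric.cthickening ε (tsupport ζ)
  have hK : IsCompact K := hc.isCompact.cthickening
  obtain ⟨δ, hδ, hδK⟩ := h _ hsub hc
  have hF : Integrable (K.indicator f) :=
    (integrable_indicator_iff hK.measurableSet).2 (hf.integrableOn_compact_subset hεΩ hK)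
  have hSK : tsupport ζ ⊆ K := Metric.self_subset_cthickening _
  have e : ∫ x in Ω, f x * Laplacian.laplacian ζ x =
      ∫ x, K.indicator f x * Laplacian.laplacian ζ x := by
    rw [← integral_indicator hΩ.measurableSet]
    congr 1 with x
    by_cases hx : x ∈ tsupport ζ
    · simp [hsub hx, hSK hx]
    · simp [laplacian_eq_zero_of_notMem_tsupport hx]
  rw [e]
  refine integral_mul_laplacian_nonpos hd hF hζ hc h0 (lt_min hδ hε) fun x hx σ hσ hσ' => ?_
  have hball : Metric.ball x σ ⊆ K := fun y hy =>
    Metric.mem_cthickening_of_dist_le y x ε _ hx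
      ((Metric.mem_ball.1 hy).le.trans (hσ'.le.trans (min_le_right _ _)))
  rw [setIntegral_congr_fun (g := f) measurableSet_ball
    (fun y hy => indicator_of_mem (hball hy) f), indicator_of_mem (hSK hx)]
  exact hδK x hx σ hσ (hσ'.trans_le (min_le_left _ _))

/-! ### Real-valued functions dominating their means -/

/-- A real function on the open set `V` is *supermean* there if it is lower semicontinuous and
dominates its mean over each ball whose closure lies in `V`. -/
structure IsSupermeanOn {d : ℕ} (w : EuclideanSpace ℝ (Fin d) → ℝ)
    (V : Set (EuclideanSpace ℝ (Fin d))) : Prop where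
  lowerSemicontinuousOn : LowerSemicontinuousOn w V
  integrableOn : ∀ x r, Metric.closedBall x r ⊆ V → IntegrableOn w (Metric.ball x r) volume
  integral_le : ∀ x r, 0 < r → Metric.closedBall x r ⊆ V →
    ∫ y in Metric.ball x r, w y ≤ volume.real (Metric.ball x r) * w x

theorem IsSupermeanOn.mono {d : ℕ} {w : EuclideanSpace ℝ (Fin d) → ℝ}
    {V W : Set (EuclideanSpace ℝ (Fin d))} (h : IsSupermeanOn w V) (hWV : W ⊆ V) :
    IsSupermeanOn w W :=
  ⟨h.1.mono hWV, fun x r hx => h.2 x r (hx.trans hWV), fun x r hr hx => h.3 x r hr (hx.trans hWV)⟩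

theorem isSupermeanOn_const {d : ℕ} (c : ℝ) (V : Set (EuclideanSpace ℝ (Fin d))) :
    IsSupermeanOn (fun _ => c) V :=
  ⟨lowerSemicontinuousOn_const, fun x r _ => Continuous.integrableOn_ball (by fun_prop) x r,
    fun x r _ _ => by simp⟩

/-- Minimum principle: a supermean function on a bounded open set whose lower limits at the
boundary are nonnegative is nonnegative. -/
theorem IsSupermeanOn.nonneg {d : ℕ} (hd : 0 < d) {V : Set (EuclideanSpace ℝ (Fin d))}
    (hV : IsOpen V) (hb : Bornology.IsBounded V) {w : EuclideanSpace ℝ (Fin d) → ℝ}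
    (hw : IsSupermeanOn w V)
    (hbd : ∀ z ∈ frontier V, ∀ c < 0, ∀ᶠ y in 𝓝[V] z, c < w y) :
    ∀ x ∈ V, 0 ≤ w x := by
  intro x₀ hx₀
  by_contra! hneg
  have hcomp : ∀ c < 0, IsCompact {x ∈ V | w x ≤ c} := by
    intro c hc
    refine Metric.isCompact_of_isClosed_isBounded (isClosed_of_closure_subset fun x hx => ?_)
      (hb.subset fun x hx => hx.1)
    have hfreq : ∃ᶠ y in 𝓝[V] x, w y ≤ c := by
      rw [frequently_nhdsWithin_iff]
      exact (mem_closure_iff_frequently.1 hx).mono fun y hy => ⟨hy.2, hy.1⟩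
    have hxV : x ∈ closure V := closure_mono (fun y hy => hy.1) hx
    by_cases hxm : x ∈ V
    · refine ⟨hxm, ?_⟩
      by_contra! hlt
      exact hfreq ((hw.1 x hxm c hlt).mono fun y hy => not_le.2 hy)
    · exact absurd ((hbd x (by rw [hV.frontier_eq]; exact ⟨hxV, hxm⟩) c hc).mono
        fun y hy => not_le.2 hy) hfreq
  obtain ⟨x₁, hx₁, hmin⟩ := (hw.1.mono (fun x hx => hx.1)).exists_isMinOn
    (s := {x ∈ V | w x ≤ w x₀}) ⟨x₀, hx₀, le_rfl⟩ (hcomp _ hneg)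
  have hle : ∀ x ∈ V, w x₁ ≤ w x := by
    intro x hx
    rcases le_total (w x) (w x₀) with h | h
    · exact hmin ⟨hx, h⟩
    · exact hx₁.2.trans h
  -- Among the minimum points choose one that is extremal in a coordinate direction.
  obtain ⟨x₂, hx₂, hmax⟩ := (hcomp (w x₁) (hx₁.2.trans_lt hneg)).exists_isMaxOn
    ⟨x₁, hx₁.1, le_rfl⟩ (f := fun x : EuclideanSpace ℝ (Fin d) => x ⟨0, hd⟩)
    (by fun_prop)
  obtain ⟨r, hr, hrV⟩ := Metric.nhds_basis_closedBall.mem_iff.1 (hV.mem_nhds hx₂.1)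
  have hint := hw.3 x₂ r hr hrV
  have hi := hw.2 x₂ r hrV
  have hx₂eq : w x₂ = w x₁ := le_antisymm hx₂.2 (hle _ hx₂.1)
  have hci : IntegrableOn (fun _ : EuclideanSpace ℝ (Fin d) => w x₁) (Metric.ball x₂ r) volume :=
    Continuous.integrableOn_ball (by fun_prop) _ _
  have hzero : ∫ y in Metric.ball x₂ r, (w y - w x₁) ≤ 0 := by
    rw [integral_sub hi hci, setIntegral_const, smul_eq_mul, ← hx₂eq]
    linarith
  refine absurd hzero (not_le.2 ?_)
  rw [setIntegral_pos_iff_support_of_nonneg_ae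
    ((ae_restrict_iff' measurableSet_ball).2 (Eventually.of_forall fun y hy =>
      sub_nonneg.2 (hle y (hrV (Metric.ball_subset_closedBall hy))))) (hi.sub hci)]
  set T := Metric.ball x₂ r ∩ {y : EuclideanSpace ℝ (Fin d) | x₂ ⟨0, hd⟩ < y ⟨0, hd⟩}
  have hT : IsOpen T := Metric.isOpen_ball.inter (isOpen_lt (by fun_prop) (by fun_prop))
  have hTne : T.Nonempty := by
    refine ⟨x₂ + EuclideanSpace.single ⟨0, hd⟩ (r / 2), ?_, ?_⟩
    · simp [abs_of_pos hr, hr]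
    · simp [hr]
  refine (hT.measure_pos volume hTne).trans_le (measure_mono fun y hy => ⟨?_, hy.1⟩)
  have hyV : y ∈ V := hrV (Metric.ball_subset_closedBall hy.1)
  rw [Function.mem_support, sub_ne_zero]
  intro heq
  have hle' : y ⟨0, hd⟩ ≤ x₂ ⟨0, hd⟩ := hmax ⟨hyV, heq.le⟩
  exact absurd hle' (not_le.2 hy.2)

/-! ### Truncation of classical superharmonic functions -/

/-- Since `min a 1` is finite for `a ≠ ⊥`, no junk value of `EReal.toReal` occurs. -/
theorem lt_toReal_min_one {a : EReal} (ha : a ≠ ⊥) (c : ℝ) :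
    c < (min a 1).toReal ↔ (c : EReal) < a ∧ c < 1 := by
  have h1 : min a 1 ≠ ⊥ := by
    rcases min_choice a 1 with h | h <;> rw [h]
    · exact ha
    · exact EReal.coe_ne_bot 1
  have h2 : min a 1 ≠ ⊤ := ((min_le_right a 1).trans_lt (by exact_mod_cast EReal.coe_lt_top 1)).ne
  rw [← EReal.coe_lt_coe_iff, EReal.coe_toReal h2 h1, lt_min_iff]
  norm_cast

theorem toReal_min_one_le {a : EReal} (ha : a ≠ ⊥) : (min a 1).toReal ≤ 1 := by
  by_contra! h
  exact lt_irrefl _ ((lt_toReal_min_one ha 1).1 h).2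

theorem coe_toReal_min_one_le {a : EReal} (ha : a ≠ ⊥) : ((min a 1).toReal : EReal) ≤ a := by
  by_contra! h
  obtain ⟨c, hc, hc'⟩ := EReal.lt_iff_exists_real_btwn.1 h
  exact absurd ((lt_toReal_min_one ha c).1 (by exact_mod_cast hc')).1 (not_lt.2 hc.le)

theorem aemeasurable_of_lowerSemicontinuousOn {d : ℕ} {w : EuclideanSpace ℝ (Fin d) → ℝ}
    {V : Set (EuclideanSpace ℝ (Fin d))} (hV : MeasurableSet V) (hw : LowerSemicontinuousOn w V) :
    AEMeasurable w (volume.restrict V) :=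
  aemeasurable_restrict_of_measurable_subtype hV
    (lowerSemicontinuous_restrict_iff.2 hw).measurable

theorem integral_le_of_ballMean_le {d : ℕ} {ψ : EuclideanSpace ℝ (Fin d) → EReal}
    {v : EuclideanSpace ℝ (Fin d) → ℝ} {x : EuclideanSpace ℝ (Fin d)} {r a : ℝ} (hr : 0 < r)
    (hv : IntegrableOn v (Metric.ball x r) volume)
    (hle : ∀ y ∈ Metric.ball x r, (v y : EReal) ≤ ψ y) (ha : ballMean ψ x r ≤ a) :
    ∫ y in Metric.ball x r, v y ≤ volume.real (Metric.ball x r) * a := by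
  have hm0 : volume (Metric.ball x r) ≠ 0 := (Metric.measure_ball_pos _ _ hr).ne'
  have hmt : volume (Metric.ball x r) ≠ ⊤ := measure_ball_lt_top.ne
  have hpos : 0 < volume.real (Metric.ball x r) := ENNReal.toReal_pos hm0 hmt
  have hP : ∫⁻ y in Metric.ball x r, ENNReal.ofReal (v y) ≠ ⊤ := hv.lintegral_lt_top.ne
  have hQ : ∫⁻ y in Metric.ball x r, ENNReal.ofReal (-v y) ≠ ⊤ := hv.neg.lintegral_lt_top.ne
  have e := integral_eq_lintegral_pos_part_sub_lintegral_neg_part hv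
  have h1 : (⨍⁻ y in Metric.ball x r, ENNReal.ofReal (v y) ∂volume) ≤
      ⨍⁻ y in Metric.ball x r, (ψ y).toENNReal ∂volume := by
    rw [setLAverage_eq, setLAverage_eq]
    refine ENNReal.div_le_div_right (setLIntegral_mono' measurableSet_ball fun y hy => ?_) _
    simpa using EReal.toENNReal_le_toENNReal (hle y hy)
  have h2 : (⨍⁻ y in Metric.ball x r, (-ψ y).toENNReal ∂volume) ≤
      ⨍⁻ y in Metric.ball x r, ENNReal.ofReal (-v y) ∂volume := by
    rw [setLAverage_eq, setLAverage_eq]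
    refine ENNReal.div_le_div_right (setLIntegral_mono' measurableSet_ball fun y hy => ?_) _
    have : -ψ y ≤ ((-v y : ℝ) : EReal) := by
      rw [EReal.coe_neg, EReal.neg_le_neg_iff]; exact hle y hy
    simpa using EReal.toENNReal_le_toENNReal this
  have h3 := (EReal.sub_le_sub (EReal.coe_ennreal_le_coe_ennreal_iff.2 h1)
    (EReal.coe_ennreal_le_coe_ennreal_iff.2 h2)).trans ha
  rw [setLAverage_eq, setLAverage_eq, ← EReal.coe_ennreal_toReal (ENNReal.div_ne_top hP hm0),
    ← EReal.coe_ennreal_toReal (ENNReal.div_ne_top hQ hm0), ← EReal.coe_sub,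
    EReal.coe_le_coe_iff, ENNReal.toReal_div, ENNReal.toReal_div, ← sub_div, ← e] at h3

  exact (div_le_iff₀' hpos).1 h3

theorem IsClassicalSuperharmonicOn.isSupermeanOn_truncation {d : ℕ}
    {ψ : EuclideanSpace ℝ (Fin d) → EReal} {U : Set (EuclideanSpace ℝ (Fin d))}
    (hψ : IsClassicalSuperharmonicOn ψ U) :
    IsSupermeanOn (fun x => (min (ψ x) 1).toReal) U := by
  have hlsc : LowerSemicontinuousOn (fun x => (min (ψ x) 1).toReal) U := by
    intro x hx c hc
    obtain ⟨h1, h2⟩ := (lt_toReal_min_one (hψ.ne_bot x hx) c).1 hc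
    filter_upwards [hψ.lowerSemicontinuousOn x hx c h1, self_mem_nhdsWithin] with y hy hyU
    exact (lt_toReal_min_one (hψ.ne_bot y hyU) c).2 ⟨hy, h2⟩
  have hint : ∀ x r, Metric.closedBall x r ⊆ U →
      IntegrableOn (fun x => (min (ψ x) 1).toReal) (Metric.ball x r) volume := by
    intro x r hxr
    obtain ⟨b, hb⟩ := (hlsc.mono hxr).bddBelow_of_isCompact (isCompact_closedBall x r)
    have hsub : Metric.ball x r ⊆ U := Metric.ball_subset_closedBall.trans hxr
    refine IntegrableOn.of_bound measure_ball_lt_top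
      (aemeasurable_of_lowerSemicontinuousOn measurableSet_ball
        (hlsc.mono hsub)).aestronglyMeasurable (max 1 |b|) ?_
    refine (ae_restrict_iff' measurableSet_ball).2 (Eventually.of_forall fun y hy => ?_)
    have hb' : b ≤ (min (ψ y) 1).toReal :=
      hb (mem_image_of_mem _ (Metric.ball_subset_closedBall hy))
    rw [Real.norm_eq_abs, abs_le]
    exact ⟨(neg_le_neg (le_max_right _ _)).trans ((neg_abs_le b).trans hb'),
      (toReal_min_one_le (hψ.ne_bot y (hsub hy))).trans (le_max_left _ _)⟩
  refine ⟨hlsc, hint, fun x r hr hxr => ?_⟩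
  have hsub : Metric.ball x r ⊆ U := Metric.ball_subset_closedBall.trans hxr
  have hx : x ∈ U := hxr (Metric.mem_closedBall_self hr.le)
  rcases le_total (ψ x) 1 with h | h
  · refine integral_le_of_ballMean_le hr (hint x r hxr)
      (fun y hy => coe_toReal_min_one_le (hψ.ne_bot y (hsub hy))) ?_
    rw [min_eq_left h, EReal.coe_toReal (h.trans_lt (by exact_mod_cast EReal.coe_lt_top 1)).ne
      (hψ.ne_bot x hx)]
    exact hψ.ballMean_le x hx r hr hxr
  · have h1 : ∫ y in Metric.ball x r, (min (ψ y) 1).toReal ≤ ∫ y in Metric.ball x r, (1 : ℝ) :=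
      setIntegral_mono_on (hint x r hxr) (Continuous.integrableOn_ball (by fun_prop) _ _)
        measurableSet_ball fun y hy => toReal_min_one_le (hψ.ne_bot y (hsub hy))
    rw [min_eq_right h]
    simpa using h1

/-! ### Admissible functions for a localized harmonic measure -/

/-- The truncated competitors in the definition of `w(·, Ω ∩ B_r(p), Ω ∩ ∂B_r(p))`: supermean
functions on `Ω ∩ B_r(p)` with values in `[0, 1]` that tend to `1` at `Ω ∩ ∂B_r(p)`. -/
structure IsAdmissible {d : ℕ} (Ω : Set (EuclideanSpace ℝ (Fin d)))
    (p : EuclideanSpace ℝ (Fin d)) (r : ℝ) (v : EuclideanSpace ℝ (Fin d) → ℝ) : Prop where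
  isSupermeanOn : IsSupermeanOn v (Ω ∩ Metric.ball p r)
  nonneg : ∀ x ∈ Ω ∩ Metric.ball p r, 0 ≤ v x
  le_one : ∀ x ∈ Ω ∩ Metric.ball p r, v x ≤ 1
  eventually_lt : ∀ z ∈ Ω ∩ Metric.sphere p r, ∀ c < 1,
    ∀ᶠ y in 𝓝[Ω ∩ Metric.ball p r] z, c < v y

theorem isAdmissible_one {d : ℕ} (Ω : Set (EuclideanSpace ℝ (Fin d)))
    (p : EuclideanSpace ℝ (Fin d)) (r : ℝ) : IsAdmissible Ω p r fun _ => 1 :=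
  ⟨isSupermeanOn_const 1 _, fun _ _ => zero_le_one, fun _ _ => le_rfl,
    fun _ _ _ hc => Eventually.of_forall fun _ => hc⟩

/-- Below any real number exceeding the localized harmonic measure at `x` lies the value at `x` of
an admissible function. Nonnegativity of the truncation is the minimum principle. -/
theorem exists_isAdmissible_of_harmonicMeasure_lt {d : ℕ} (hd : 0 < d)
    {Ω : Set (EuclideanSpace ℝ (Fin d))} (hΩ : IsOpen Ω) {p x : EuclideanSpace ℝ (Fin d)}
    {r c : ℝ} (hr : 0 < r) (hx : x ∈ Ω ∩ Metric.ball p r)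
    (h : harmonicMeasure x (Ω ∩ Metric.ball p r) (Ω ∩ Metric.sphere p r) < c) :
    ∃ v, IsAdmissible Ω p r v ∧ v x ≤ c := by
  rw [harmonicMeasure, pwbSolution] at h
  simp only [iInf_lt_iff] at h
  obtain ⟨ψ, ⟨hψ, hbd⟩, hlt⟩ := h
  have hU : IsOpen (Ω ∩ Metric.ball p r) := hΩ.inter Metric.isOpen_ball
  have hev : ∀ z ∈ frontier (Ω ∩ Metric.ball p r), ∀ c : ℝ, c < 1 →
      c < (Ω ∩ Metric.sphere p r).indicator (fun _ => (1 : ℝ)) z →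
      ∀ᶠ y in 𝓝[Ω ∩ Metric.ball p r] z, c < (min (ψ y) 1).toReal := by
    intro z hz c hc1 hc
    have h1 : (c : EReal) < liminf ψ (𝓝[Ω ∩ Metric.ball p r] z) :=
      (EReal.coe_lt_coe_iff.2 hc).trans_le (hbd z hz)
    filter_upwards [eventually_lt_of_lt_liminf h1, self_mem_nhdsWithin] with y hy hyU
    exact (lt_toReal_min_one (hψ.ne_bot y hyU) c).2 ⟨hy, hc1⟩
  refine ⟨fun y => (min (ψ y) 1).toReal, ⟨hψ.isSupermeanOn_truncation, ?_, ?_, ?_⟩, ?_⟩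
  · refine hψ.isSupermeanOn_truncation.nonneg hd hU
      (Metric.isBounded_ball.subset inter_subset_right) fun z hz c hc => ?_
    exact hev z hz c (hc.trans one_pos) (hc.trans_le (indicator_nonneg (by simp) z))
  · exact fun y hy => toReal_min_one_le (hψ.ne_bot y hy)
  · intro z hz c hc
    refine hev z ?_ c hc (by rwa [indicator_of_mem hz])
    rw [hU.frontier_eq]
    refine ⟨hΩ.inter_closure ⟨hz.1, ?_⟩, fun hz' => ?_⟩
    · rw [closure_ball p hr.ne']
      exact Metric.sphere_subset_closedBall hz.2
    · exact (Metric.mem_ball.1 hz'.2).ne hz.2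
  · have := (coe_toReal_min_one_le (hψ.ne_bot x hx)).trans hlt.le
    exact_mod_cast this

/-! ### A quadratic barrier at the sphere -/

/-- Harmonic quadratic polynomials have the mean value property. -/
theorem integral_ball_of_trace_eq_zero {d : ℕ} (hd : 0 < d)
    {h : EuclideanSpace ℝ (Fin d) → ℝ} {x : EuclideanSpace ℝ (Fin d)}
    (l : EuclideanSpace ℝ (Fin d) →L[ℝ] ℝ)
    (B : EuclideanSpace ℝ (Fin d) →L[ℝ] EuclideanSpace ℝ (Fin d) →L[ℝ] ℝ)
    (hB : ∑ i, B (EuclideanSpace.basisFun (Fin d) ℝ i) (EuclideanSpace.basisFun (Fin d) ℝ i) = 0)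
    (hx : ∀ u, h (x + u) = h x + l u + B u u) (σ : ℝ) :
    ∫ y in Metric.ball x σ, h y = volume.real (Metric.ball x σ) * h x := by
  rw [← setIntegral_ball_add]
  simp_rw [hx]
  have hc : Continuous fun u => B u u := by fun_prop
  have hl : IntegrableOn (fun u => h x + l u) (Metric.ball 0 σ) volume :=
    Continuous.integrableOn_ball (by fun_prop) _ _
  rw [integral_add hl (hc.integrableOn_ball _ _),
    integral_add (Continuous.integrableOn_ball (by fun_prop) _ _)
      (Continuous.integrableOn_ball (by fun_prop) _ _), integral_ball_clm]
  have h2 := mul_integral_ball_bilin σ B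
  rw [hB, mul_zero] at h2
  have hd' : (d : ℝ) ≠ 0 := by positivity
  rw [(mul_eq_zero.1 h2).resolve_left hd', setIntegral_const, smul_eq_mul, add_zero, add_zero,
    measureReal_def, measureReal_def, Measure.addHaar_ball_center volume x σ]

/-- A harmonic quadratic polynomial with value `1` at `z`. It is at most `1` on the part of
`B_s(z)` in the half-space `⟪n, z - x⟫ ≥ 0`, and at most `0` where moreover `|x - z| = s`. -/
noncomputable def quadBarrier {d : ℕ} (z n : EuclideanSpace ℝ (Fin d)) (s : ℝ)
    (x : EuclideanSpace ℝ (Fin d)) : ℝ :=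
  1 - d * (inner ℝ n (z - x) / s) - (‖z - x‖ / s) ^ 2 + d * (inner ℝ n (z - x) / s) ^ 2

theorem continuous_quadBarrier {d : ℕ} (z n : EuclideanSpace ℝ (Fin d)) (s : ℝ) :
    Continuous (quadBarrier z n s) := by
  unfold quadBarrier
  fun_prop

theorem integral_ball_quadBarrier {d : ℕ} (hd : 0 < d) (z : EuclideanSpace ℝ (Fin d))
    {n : EuclideanSpace ℝ (Fin d)} (hn : ‖n‖ = 1) (s : ℝ) (x : EuclideanSpace ℝ (Fin d)) (σ : ℝ) :
    ∫ y in Metric.ball x σ, quadBarrier z n s y =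
      volume.real (Metric.ball x σ) * quadBarrier z n s x := by
  obtain ⟨J, hJ⟩ : ∃ J : EuclideanSpace ℝ (Fin d) →L[ℝ] EuclideanSpace ℝ (Fin d) →L[ℝ] ℝ,
      ∀ a b, J a b = inner ℝ a b := ⟨innerSL ℝ, fun _ _ => rfl⟩
  refine integral_ball_of_trace_eq_zero hd
    ((d * s⁻¹) • J n + (2 * (s⁻¹) ^ 2) • J (z - x) -
      (2 * d * (s⁻¹) ^ 2 * inner ℝ n (z - x)) • J n)
    ((d * (s⁻¹) ^ 2) • (J n).smulRight (J n) - ((s⁻¹) ^ 2) • J) ?_ ?_ σ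
  · have h1 : ∑ i, inner ℝ n (EuclideanSpace.basisFun (Fin d) ℝ i) ^ 2 = 1 := by
      have := (EuclideanSpace.basisFun (Fin d) ℝ).sum_sq_norm_inner_left n
      simpa [hn] using this
    simp only [sub_apply, smul_apply, ContinuousLinearMap.smulRight_apply, hJ,
      smul_eq_mul, Finset.sum_sub_distrib, ← Finset.mul_sum, ← pow_two, h1]
    simp [mul_comm]
  · intro u
    have e1 : z - (x + u) = (z - x) - u := by abel
    simp only [quadBarrier, e1, inner_sub_right, sub_apply, add_apply, smul_apply,
      ContinuousLinearMap.smulRight_apply, hJ, smul_eq_mul, div_pow,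
      real_inner_self_eq_norm_sq, norm_sub_sq_real]
    ring

theorem quadBarrier_le {d : ℕ} {z n x : EuclideanSpace ℝ (Fin d)} (hn : ‖n‖ = 1) {s : ℝ}
    (hs : 0 < s) (hx : ‖z - x‖ ≤ s) (h0 : 0 ≤ inner ℝ n (z - x)) :
    quadBarrier z n s x ≤ 1 - (‖z - x‖ / s) ^ 2 := by
  have h1 : inner ℝ n (z - x) ≤ s := by
    have := real_inner_le_norm n (z - x)
    rw [hn, one_mul] at this
    exact this.trans hx
  have h2 : inner ℝ n (z - x) / s ≤ 1 := (div_le_one hs).2 h1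
  have h3 : 0 ≤ inner ℝ n (z - x) / s := by positivity
  have h4 : (inner ℝ n (z - x) / s) ^ 2 ≤ inner ℝ n (z - x) / s := by nlinarith
  have := mul_le_mul_of_nonneg_left h4 (Nat.cast_nonneg (α := ℝ) d)
  unfold quadBarrier
  linarith

theorem three_quarters_le_quadBarrier {d : ℕ} {z n x : EuclideanSpace ℝ (Fin d)} (hn : ‖n‖ = 1)
    {s : ℝ} (hs : 0 < s) (hx : 4 * (d + 1) * ‖z - x‖ ≤ s) : 3 / 4 ≤ quadBarrier z n s x := by
  have h1 : inner ℝ n (z - x) / s ≤ ‖z - x‖ / s := by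
    have := real_inner_le_norm n (z - x)
    rw [hn, one_mul] at this
    gcongr
  have h2 : 4 * (d + 1) * (‖z - x‖ / s) ≤ 1 := by
    rw [← mul_div_assoc]; exact (div_le_one hs).2 hx
  have hd : (0 : ℝ) ≤ d := Nat.cast_nonneg d
  have h3 : 0 ≤ ‖z - x‖ / s := by positivity
  have h4 : ‖z - x‖ / s ≤ 1 := by nlinarith
  have h5 : (‖z - x‖ / s) ^ 2 ≤ ‖z - x‖ / s := by nlinarith
  have h6 := mul_le_mul_of_nonneg_left h1 hd
  have h7 : 0 ≤ d * (inner ℝ n (z - x) / s) ^ 2 := by positivity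
  unfold quadBarrier
  linarith

/-- Near a point `z` of the sphere `∂B_r(p)` around which `Ω` contains a ball, admissible
functions are close to `1`, uniformly in the function. -/
theorem IsAdmissible.three_quarters_le {d : ℕ} (hd : 0 < d)
    {Ω : Set (EuclideanSpace ℝ (Fin d))} (hΩ : IsOpen Ω) {p n x : EuclideanSpace ℝ (Fin d)}
    {r s : ℝ} {v : EuclideanSpace ℝ (Fin d) → ℝ} (hv : IsAdmissible Ω p r v) (hn : ‖n‖ = 1)
    (hs : 0 < s) (hsΩ : Metric.ball (p + r • n) s ⊆ Ω) (hx : x ∈ Ω ∩ Metric.ball p r)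
    (hxs : 4 * (d + 1) * ‖p + r • n - x‖ ≤ s) : 3 / 4 ≤ v x := by
  set z := p + r • n with hz
  set V := (Ω ∩ Metric.ball p r) ∩ Metric.ball z s
  have hV : IsOpen V := (hΩ.inter Metric.isOpen_ball).inter Metric.isOpen_ball
  have hh := continuous_quadBarrier z n s
  have hw : IsSupermeanOn (fun y => v y - quadBarrier z n s y) V := by
    have hvV : IsSupermeanOn v V := hv.isSupermeanOn.mono inter_subset_left
    refine ⟨?_, fun y σ hy => (hvV.2 y σ hy).sub (hh.integrableOn_ball y σ),
      fun y σ hσ hy => ?_⟩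
    · simp only [sub_eq_add_neg]
      exact hvV.1.add (hh.neg.continuousOn.lowerSemicontinuousOn)
    · rw [integral_sub (hvV.2 y σ hy) (hh.integrableOn_ball y σ),
        integral_ball_quadBarrier hd z hn s]
      have := hvV.3 y σ hσ hy
      linarith
  have hτ : ∀ q ∈ Metric.closedBall p r, 0 ≤ inner ℝ n (z - q) := by
    intro q hq
    have e : z - q = r • n - (q - p) := by rw [hz]; abel
    have h1 := real_inner_le_norm n (q - p)
    rw [hn, one_mul] at h1
    have h2 : ‖q - p‖ ≤ r := by rwa [Metric.mem_closedBall, dist_eq_norm] at hq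
    rw [e, inner_sub_right, inner_smul_right, real_inner_self_eq_norm_sq, hn]
    linarith
  have hbd : ∀ q ∈ frontier V, ∀ c < 0, ∀ᶠ y in 𝓝[V] q, c < v y - quadBarrier z n s y := by
    intro q hq c hc
    rw [hV.frontier_eq] at hq
    have hqp : q ∈ Metric.closedBall p r :=
      Metric.closure_ball_subset_closedBall (closure_mono (fun y hy => hy.1.2) hq.1)
    have hqz : q ∈ Metric.closedBall z s :=
      Metric.closure_ball_subset_closedBall (closure_mono (fun y hy => hy.2) hq.1)
    have hqz' : ‖z - q‖ ≤ s := by rwa [Metric.mem_closedBall', dist_eq_norm] at hqz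
    have hle := quadBarrier_le hn hs hqz' (hτ q hqp)
    have hnear : ∀ᶠ y in 𝓝[V] q, quadBarrier z n s y < quadBarrier z n s q - c / 2 :=
      nhdsWithin_le_nhds (hh.continuousAt.eventually_lt_const (by linarith))
    rcases hqz'.lt_or_eq with hlt | heq
    · have hqs : q ∈ Metric.ball z s := by rwa [Metric.mem_ball', dist_eq_norm]
      have hqsph : q ∈ Metric.sphere p r := by
        by_contra hne
        exact hq.2 ⟨⟨hsΩ hqs, lt_of_le_of_ne hqp hne⟩, hqs⟩
      have hev := hv.eventually_lt q ⟨hsΩ hqs, hqsph⟩ (1 + c / 2) (by linarith)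
      filter_upwards [nhdsWithin_mono q inter_subset_left hev, hnear] with y h1 h2
      have : 0 ≤ (‖z - q‖ / s) ^ 2 := by positivity
      linarith
    · rw [heq, div_self hs.ne'] at hle
      filter_upwards [self_mem_nhdsWithin, hnear] with y h1 h2
      have := hv.nonneg y h1.1
      linarith
  have hxV : x ∈ V := by
    refine ⟨hx, ?_⟩
    rw [Metric.mem_ball', dist_eq_norm]
    have hd' : (1 : ℝ) ≤ d := by exact_mod_cast hd
    nlinarith [norm_nonneg (z - x)]
  have h1 := hw.nonneg hd hV (Metric.isBounded_ball.subset inter_subset_right) hbd x hxV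
  have h2 := three_quarters_le_quadBarrier hn hs hxs
  linarith

/-! ### The infimum of the rescaled admissible functions -/

theorem closedBall_subset_of_lt_infDist_frontier {d : ℕ} {Ω : Set (EuclideanSpace ℝ (Fin d))}
    (hΩ : IsOpen Ω) {y : EuclideanSpace ℝ (Fin d)} {σ : ℝ} (hy : y ∈ Ω)
    (hσ : σ < Metric.infDist y (frontier Ω)) : Metric.closedBall y σ ⊆ Ω := by
  rcases lt_or_ge σ 0 with h0 | h0
  · simp [Metric.closedBall_eq_empty.2 h0]
  have hdisj : ∀ z ∈ Metric.closedBall y σ, z ∉ frontier Ω := fun z hz hz' =>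
    absurd ((Metric.infDist_le_dist_of_mem hz').trans (Metric.mem_closedBall'.1 hz))
      (not_le.2 hσ)
  have hpre : IsPreconnected (Metric.closedBall y σ) := (convex_closedBall y σ).isPreconnected
  refine hpre.subset_left_of_subset_union hΩ isClosed_closure.isOpen_compl
    (disjoint_compl_right.mono_left subset_closure) (fun z hz => ?_)
    ⟨y, Metric.mem_closedBall_self h0, hy⟩
  by_cases h1 : z ∈ Ω
  · exact Or.inl h1
  · refine Or.inr fun h2 => hdisj z hz ?_
    rw [hΩ.frontier_eq]
    exact ⟨h2, h1⟩

theorem infDist_frontier_pos {d : ℕ} {Ω : Set (EuclideanSpace ℝ (Fin d))}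
    (hΩ : IsOpen Ω) (hne : (frontier Ω).Nonempty) {y : EuclideanSpace ℝ (Fin d)} (hy : y ∈ Ω) :
    0 < Metric.infDist y (frontier Ω) := by
  rw [← isClosed_frontier.notMem_iff_infDist_pos hne, hΩ.frontier_eq]
  exact fun h => h.2 hy

/-- The infimum of `r ^ β * (v y + ε)` over all boundary points `p`, radii `r` with
`y ∈ Ω ∩ B_r(p)` and functions `v` admissible for `p` and `r`. -/
noncomputable def admissibleInf {d : ℕ} (Ω : Set (EuclideanSpace ℝ (Fin d))) (β ε : ℝ)
    (y : EuclideanSpace ℝ (Fin d)) : ℝ≥0∞ :=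
  ⨅ (p : EuclideanSpace ℝ (Fin d)) (r : ℝ) (v : EuclideanSpace ℝ (Fin d) → ℝ)
    (_ : p ∈ frontier Ω ∧ y ∈ Ω ∩ Metric.ball p r ∧ IsAdmissible Ω p r v),
    ENNReal.ofReal (r ^ β * (v y + ε))

theorem admissibleInf_le {d : ℕ} {Ω : Set (EuclideanSpace ℝ (Fin d))} (β ε : ℝ)
    {y p : EuclideanSpace ℝ (Fin d)} {r : ℝ} {v : EuclideanSpace ℝ (Fin d) → ℝ}
    (hp : p ∈ frontier Ω) (hy : y ∈ Ω ∩ Metric.ball p r) (hv : IsAdmissible Ω p r v) :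
    admissibleInf Ω β ε y ≤ ENNReal.ofReal (r ^ β * (v y + ε)) :=
  iInf_le_of_le p <| iInf_le_of_le r <| iInf_le_of_le v <| iInf_le _ ⟨hp, hy, hv⟩

theorem le_admissibleInf {d : ℕ} {Ω : Set (EuclideanSpace ℝ (Fin d))} {β ε : ℝ} (hβ : 0 < β)
    (hε : 0 < ε) (y : EuclideanSpace ℝ (Fin d)) :
    ENNReal.ofReal (ε * Metric.infDist y (frontier Ω) ^ β) ≤ admissibleInf Ω β ε y := by
  refine le_iInf fun p => le_iInf fun r => le_iInf fun v => le_iInf fun h => ?_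
  obtain ⟨hp, hy, hv⟩ := h
  refine ENNReal.ofReal_le_ofReal ?_
  have h1 : Metric.infDist y (frontier Ω) ≤ r :=
    (Metric.infDist_le_dist_of_mem hp).trans (Metric.mem_ball.1 hy.2).le
  have h2 := Real.rpow_le_rpow Metric.infDist_nonneg h1 hβ.le
  have h3 := hv.nonneg y hy
  have h4 : 0 ≤ Metric.infDist y (frontier Ω) ^ β := Real.rpow_nonneg Metric.infDist_nonneg _
  rw [mul_comm]
  exact mul_le_mul h2 (by linarith) hε.le (h4.trans h2)

theorem admissibleInf_le_infDist_rpow {d : ℕ} {Ω : Set (EuclideanSpace ℝ (Fin d))}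
    (hΩ : IsOpen Ω) (hne : (frontier Ω).Nonempty) (β ε : ℝ)
    {y : EuclideanSpace ℝ (Fin d)} (hy : y ∈ Ω) :
    admissibleInf Ω β ε y ≤
      ENNReal.ofReal ((2 * Metric.infDist y (frontier Ω)) ^ β * (1 + ε)) := by
  obtain ⟨p, hp, hpy⟩ := isClosed_frontier.exists_infDist_eq_dist hne y
  have hpos := infDist_frontier_pos hΩ hne hy
  refine admissibleInf_le β ε hp ⟨hy, ?_⟩ (isAdmissible_one Ω p _)
  rw [Metric.mem_ball, ← hpy]
  linarith

/-- The lower semicontinuous envelope `x ↦ liminf_{y → x} g y`, the point `x` included. -/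
noncomputable def lscEnvelope {X : Type*} [TopologicalSpace X] (g : X → ℝ≥0∞) (x : X) : ℝ≥0∞ :=
  liminf g (𝓝 x)

theorem lscEnvelope_le {X : Type*} [TopologicalSpace X] (g : X → ℝ≥0∞) (x : X) :
    lscEnvelope g x ≤ g x :=
  liminf_le_of_frequently_le' (Frequently.filter_mono (frequently_pure.2 le_rfl) (pure_le_nhds x))

theorem le_lscEnvelope {X : Type*} [TopologicalSpace X] {g : X → ℝ≥0∞} {x : X} {a : ℝ≥0∞}
    (h : ∀ᶠ y in 𝓝 x, a ≤ g y) : a ≤ lscEnvelope g x :=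
  le_liminf_of_le (by isBoundedDefault) h

theorem lowerSemicontinuous_lscEnvelope {X : Type*} [TopologicalSpace X] (g : X → ℝ≥0∞) :
    LowerSemicontinuous (lscEnvelope g) := by
  intro x a ha
  obtain ⟨b, hab, hb⟩ := exists_between ha
  have h : ∀ᶠ y in 𝓝 x, b < g y := eventually_lt_of_lt_liminf hb
  filter_upwards [h.eventually_nhds] with y hy
  exact hab.trans_le (le_lscEnvelope (hy.mono fun z hz => hz.le))

/-- On a ball inside the domain of an admissible function, the mean value inequality of that
function passes to the envelope on the left-hand side. -/
theorem setLIntegral_lscEnvelope_le {d : ℕ} {Ω : Set (EuclideanSpace ℝ (Fin d))} {β ε : ℝ}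
    (hε : 0 < ε) {y p : EuclideanSpace ℝ (Fin d)} {r σ : ℝ}
    {v : EuclideanSpace ℝ (Fin d) → ℝ} (hr : 0 ≤ r) (hσ : 0 < σ)
    (hp : p ∈ frontier Ω) (hy : Metric.closedBall y σ ⊆ Ω ∩ Metric.ball p r)
    (hv : IsAdmissible Ω p r v) :
    ∫⁻ x in Metric.ball y σ, lscEnvelope (admissibleInf Ω β ε) x ≤
      volume (Metric.ball y σ) * ENNReal.ofReal (r ^ β * (v y + ε)) := by
  have hsub : Metric.ball y σ ⊆ Ω ∩ Metric.ball p r := Metric.ball_subset_closedBall.trans hy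
  have hrβ : 0 ≤ r ^ β := Real.rpow_nonneg hr β
  have hi : IntegrableOn (fun x => r ^ β * (v x + ε)) (Metric.ball y σ) volume :=
    ((hv.isSupermeanOn.integrableOn y σ hy).add
      (Continuous.integrableOn_ball (g := fun _ => ε) (by fun_prop) y σ)).const_mul _
  calc ∫⁻ x in Metric.ball y σ, lscEnvelope (admissibleInf Ω β ε) x
      ≤ ∫⁻ x in Metric.ball y σ, ENNReal.ofReal (r ^ β * (v x + ε)) :=
        setLIntegral_mono' measurableSet_ball fun x hx =>
          (lscEnvelope_le _ x).trans (admissibleInf_le β ε hp (hsub hx) hv)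
    _ = ENNReal.ofReal (∫ x in Metric.ball y σ, r ^ β * (v x + ε)) := by
        rw [ofReal_integral_eq_lintegral_ofReal hi]
        refine (ae_restrict_iff' measurableSet_ball).2 (Eventually.of_forall fun x hx => ?_)
        have := hv.nonneg x (hsub hx)
        simp only [Pi.zero_apply]
        positivity
    _ ≤ ENNReal.ofReal (volume.real (Metric.ball y σ) * (r ^ β * (v y + ε))) := by
        refine ENNReal.ofReal_le_ofReal ?_
        rw [integral_const_mul, integral_add (hv.isSupermeanOn.integrableOn y σ hy)
          (Continuous.integrableOn_ball (by fun_prop) y σ), setIntegral_const, smul_eq_mul]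
        have := mul_le_mul_of_nonneg_left (hv.isSupermeanOn.integral_le y σ hσ hy) hrβ
        linarith
    _ = volume (Metric.ball y σ) * ENNReal.ofReal (r ^ β * (v y + ε)) := by
        rw [ENNReal.ofReal_mul measureReal_nonneg, measureReal_def,
          ENNReal.ofReal_toReal measure_ball_lt_top.ne]

/-- The decay property gives an admissible function for a ball about a boundary point nearest to
`y` that is small at `y`. The factor `2` makes room for approximating the harmonic measure. -/
theorem LHMDWith.exists_isAdmissible {d : ℕ} (hd : 0 < d) {Ω : Set (EuclideanSpace ℝ (Fin d))}
    (hΩ : IsOpen Ω) (hne : (frontier Ω).Nonempty) {α M A : ℝ} (hα : 0 < α) (hM : 0 < M)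
    (hA : 1 < A) (h : LHMDWith Ω α M) {y : EuclideanSpace ℝ (Fin d)} (hy : y ∈ Ω) {r : ℝ}
    (hr : Metric.infDist y (frontier Ω) ≤ r) :
    ∃ p ∈ frontier Ω, Metric.infDist y (frontier Ω) = dist y p ∧
      ∃ v, IsAdmissible Ω p (A * r) v ∧ v y ≤ 2 * M * A ^ (-α) := by
  obtain ⟨p, hp, hpy⟩ := isClosed_frontier.exists_infDist_eq_dist hne y
  have hr0 : 0 < r := (infDist_frontier_pos hΩ hne hy).trans_le hr
  have hA0 : 0 < A := one_pos.trans hA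
  have hyU : y ∈ Ω ∩ Metric.ball p (A * r) := by
    refine ⟨hy, ?_⟩
    rw [Metric.mem_ball, ← hpy]
    nlinarith
  refine ⟨p, hp, hpy, exists_isAdmissible_of_harmonicMeasure_lt hd hΩ (by positivity) hyU
    ((h p hp _ (by positivity) y hyU).trans_lt (EReal.coe_lt_coe_iff.2 ?_))⟩
  have h1 : (dist y p / (A * r)) ^ α ≤ A ^ (-α) := by
    rw [Real.rpow_neg hA0.le, ← Real.inv_rpow hA0.le]
    refine Real.rpow_le_rpow (by positivity) ?_ hα.le
    rw [div_le_iff₀ (by positivity), inv_mul_cancel_left₀ hA0.ne', ← hpy]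
    exact hr
  have h2 : 0 < A ^ (-α) := Real.rpow_pos_of_pos hA0 _
  nlinarith [mul_le_mul_of_nonneg_left h1 hM.le, mul_pos hM h2]

/-- The envelope of the infimum lies below every member of the family in the mean, for balls of
uniform size. -/
theorem setLIntegral_lscEnvelope_le_admissibleInf {d : ℕ} (hd : 0 < d)
    {Ω : Set (EuclideanSpace ℝ (Fin d))} (hΩ : IsOpen Ω) (hne : (frontier Ω).Nonempty)
    {α β ε M A : ℝ} (hα : 0 < α) (hε : 0 < ε) (hM : 0 < M) (hA : 2 ≤ A)
    (hAε : A ^ β * (2 * M * A ^ (-α) + ε) ≤ 3 / 4) (h : LHMDWith Ω α M)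
    {y : EuclideanSpace ℝ (Fin d)} (hy : y ∈ Ω) {σ : ℝ} (hσ : 0 < σ)
    (hσy : 8 * (d + 1) * σ ≤ Metric.infDist y (frontier Ω)) :
    ∫⁻ x in Metric.ball y σ, lscEnvelope (admissibleInf Ω β ε) x ≤
      volume (Metric.ball y σ) * admissibleInf Ω β ε y := by
  have hv0 : volume (Metric.ball y σ) ≠ 0 := (Metric.measure_ball_pos _ _ hσ).ne'
  have hvt : volume (Metric.ball y σ) ≠ ⊤ := measure_ball_lt_top.ne
  have hd' : (1 : ℝ) ≤ d := by exact_mod_cast hd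
  set ρ := Metric.infDist y (frontier Ω)
  have hσρ : 16 * σ ≤ ρ := by nlinarith
  rw [← ENNReal.div_le_iff' hv0 hvt]
  refine le_iInf fun p => le_iInf fun r => le_iInf fun v => le_iInf fun h' => ?_
  obtain ⟨hp, hyU, hv⟩ := h'
  rw [ENNReal.div_le_iff' hv0 hvt]
  have hdr : dist y p < r := hyU.2
  have hr0 : 0 < r := dist_nonneg.trans_lt hdr
  have hρp : ρ ≤ dist y p := Metric.infDist_le_dist_of_mem hp
  have hσΩ : Metric.closedBall y σ ⊆ Ω :=
    closedBall_subset_of_lt_infDist_frontier hΩ hy (by linarith)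
  rcases lt_or_ge (dist y p + σ) r with hlt | hge
  · refine setLIntegral_lscEnvelope_le hε hr0.le hσ hp (subset_inter hσΩ fun x hx => ?_) hv
    have := dist_triangle x y p
    rw [Metric.mem_closedBall] at hx
    rw [Metric.mem_ball]
    linarith
  -- Here `y` is close to the sphere, so `v y` is almost `1`; the radius `A * r` does better.
  · have hyp : 0 < ‖y - p‖ := by rw [← dist_eq_norm]; linarith
    have hv34 : 3 / 4 ≤ v y := by
      have hn : ‖(‖y - p‖⁻¹) • (y - p)‖ = 1 := by
        rw [norm_smul, norm_inv, norm_norm, inv_mul_cancel₀ hyp.ne']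
      have hz : ‖p + r • (‖y - p‖⁻¹) • (y - p) - y‖ ≤ σ := by
        have e : p + r • (‖y - p‖⁻¹) • (y - p) - y =
            (r - ‖y - p‖) • (‖y - p‖⁻¹) • (y - p) := by
          rw [sub_smul, smul_inv_smul₀ hyp.ne']
          abel
        rw [dist_eq_norm] at hdr hge
        rw [e, norm_smul, hn, mul_one, Real.norm_eq_abs, abs_of_nonneg (by linarith)]
        linarith
      refine hv.three_quarters_le hd hΩ hn (s := ρ / 2) (by linarith) (fun x hx => ?_) hyU ?_
      · refine closedBall_subset_of_lt_infDist_frontier hΩ hy (σ := ρ / 2 + σ) (by linarith) ?_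
        rw [← dist_eq_norm] at hz
        rw [Metric.mem_closedBall]
        exact (dist_triangle _ _ _).trans (add_le_add (Metric.mem_ball.1 hx).le hz)
      · have : 4 * (d + 1 : ℝ) * ‖p + r • (‖y - p‖⁻¹) • (y - p) - y‖ ≤ 4 * (d + 1) * σ := by
          gcongr
        linarith
    obtain ⟨q, hq, hqy, u, hu, huy⟩ :=
      h.exists_isAdmissible hd hΩ hne hα hM (by linarith : (1 : ℝ) < A) hy (hρp.trans hdr.le)
    refine (setLIntegral_lscEnvelope_le hε (by positivity) hσ hq
      (subset_inter hσΩ fun x hx => ?_) hu).trans ?_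
    · have := dist_triangle x y q
      rw [Metric.mem_closedBall] at hx
      rw [Metric.mem_ball]
      nlinarith
    · refine mul_le_mul_right (ENNReal.ofReal_le_ofReal ?_) _
      rw [Real.mul_rpow (by linarith) hr0.le, mul_comm (A ^ β), mul_assoc]
      have hAβ : 0 ≤ A ^ β := Real.rpow_nonneg (by linarith) β
      have := mul_le_mul_of_nonneg_left (add_le_add_left huy ε) hAβ
      exact mul_le_mul_of_nonneg_left (by linarith) (Real.rpow_nonneg hr0.le β)

/-- The mean value inequality for the envelope. It is obtained for balls of radius `τ < σ` about `x`,
which lie in the balls of radius `σ` about nearby points; then `τ` increases to `σ`. -/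
theorem setLIntegral_lscEnvelope_le_lscEnvelope {d : ℕ} (hd : 0 < d)
    {Ω : Set (EuclideanSpace ℝ (Fin d))} (hΩ : IsOpen Ω) (hne : (frontier Ω).Nonempty)
    {α β ε M A : ℝ} (hα : 0 < α) (hε : 0 < ε) (hM : 0 < M) (hA : 2 ≤ A)
    (hAε : A ^ β * (2 * M * A ^ (-α) + ε) ≤ 3 / 4) (h : LHMDWith Ω α M)
    {x : EuclideanSpace ℝ (Fin d)} (hx : x ∈ Ω) {σ : ℝ} (hσ : 0 < σ)
    (hσx : 8 * (d + 1) * σ < Metric.infDist x (frontier Ω)) :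
    ∫⁻ y in Metric.ball x σ, lscEnvelope (admissibleInf Ω β ε) y ≤
      volume (Metric.ball x σ) * lscEnvelope (admissibleInf Ω β ε) x := by
  set Φ := admissibleInf Ω β ε
  have hv0 : volume (Metric.ball x σ) ≠ 0 := (Metric.measure_ball_pos _ _ hσ).ne'
  have hvt : volume (Metric.ball x σ) ≠ ⊤ := measure_ball_lt_top.ne
  have hsmall : ∀ τ < σ, ∫⁻ y in Metric.ball x τ, lscEnvelope Φ y ≤
      volume (Metric.ball x σ) * lscEnvelope Φ x := by
    intro τ hτ
    rw [← ENNReal.div_le_iff' hv0 hvt]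
    refine le_lscEnvelope ?_
    have hcont : ∀ᶠ y in 𝓝 x, 8 * (d + 1) * σ < Metric.infDist y (frontier Ω) :=
      (Metric.continuous_infDist_pt _).continuousAt.eventually_const_lt hσx
    filter_upwards [hcont, hΩ.mem_nhds hx, Metric.ball_mem_nhds x (sub_pos.2 hτ)]
      with y hy hyΩ hyx
    rw [ENNReal.div_le_iff' hv0 hvt, Measure.addHaar_ball_center volume x σ,
      ← Measure.addHaar_ball_center volume y σ]
    refine le_trans (lintegral_mono_set (Metric.ball_subset_ball' ?_))
      (setLIntegral_lscEnvelope_le_admissibleInf hd hΩ hne hα hε hM hA hAε h hyΩ hσ hy.le)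
    rw [Metric.mem_ball, dist_comm] at hyx
    linarith
  have hU : Metric.ball x σ = ⋃ n : ℕ, Metric.ball x (σ - 1 / (n + 1)) := by
    ext y
    simp only [Metric.mem_ball, mem_iUnion]
    constructor
    · intro hy
      obtain ⟨n, hn⟩ := exists_nat_one_div_lt (sub_pos.2 hy)
      exact ⟨n, by linarith⟩
    · rintro ⟨n, hn⟩
      have : (0 : ℝ) < 1 / (n + 1) := by positivity
      linarith
  have hmono : Monotone fun n : ℕ => Metric.ball x (σ - 1 / ((n : ℝ) + 1)) := fun m n hmn =>
    Metric.ball_subset_ball (sub_le_sub_left (Nat.one_div_le_one_div hmn) σ)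
  conv_lhs => rw [hU]
  rw [setLIntegral_iUnion_of_directed _ hmono.directed_le]
  refine iSup_le fun n => hsmall _ ?_
  have : (0 : ℝ) < 1 / (n + 1) := by positivity
  linarith

/-! ### Existence of the superharmonic function -/

/-- The ratio `A` of radii for which the boundary decay `A ^ (-α)` outweighs the growth `A ^ β` of the
weights, with `ε = A ^ (-β) / 2`. -/
theorem exists_radius_ratio {α β M : ℝ} (hβα : β < α) :
    ∃ A : ℝ, 2 ≤ A ∧ A ^ β * (2 * M * A ^ (-α) + A ^ (-β) / 2) ≤ 3 / 4 := by
  have ht : Tendsto (fun A : ℝ => 2 * M * A ^ (-(α - β))) atTop (𝓝 (2 * M * 0)) :=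
    (tendsto_rpow_neg_atTop (sub_pos.2 hβα)).const_mul _
  rw [mul_zero] at ht
  obtain ⟨A, hA, hA2⟩ := ((ht.eventually_le_const (by norm_num : (0 : ℝ) < 1 / 4)).and
    (eventually_ge_atTop 2)).exists
  refine ⟨A, hA2, ?_⟩
  have hA0 : 0 < A := by linarith
  have e1 : A ^ (-(α - β)) = A ^ β * A ^ (-α) := by
    rw [← Real.rpow_add hA0]; congr 1; ring
  have e2 : A ^ β * A ^ (-β) = 1 := by
    rw [← Real.rpow_add hA0]; simp
  rw [e1] at hA
  linarith

theorem isSuperharmonicOn_lscEnvelope {d : ℕ} (hd : 0 < d)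
    {Ω : Set (EuclideanSpace ℝ (Fin d))} (hΩ : IsOpen Ω) (hne : (frontier Ω).Nonempty)
    {α β ε M A : ℝ} (hα : 0 < α) (hβ : 0 < β) (hε : 0 < ε) (hM : 0 < M) (hA : 2 ≤ A)
    (hAε : A ^ β * (2 * M * A ^ (-α) + ε) ≤ 3 / 4) (h : LHMDWith Ω α M) :
    IsSuperharmonicOn (fun x => (lscEnvelope (admissibleInf Ω β ε) x).toReal) Ω := by
  set g := lscEnvelope (admissibleInf Ω β ε)
  have hgm : Measurable g := (lowerSemicontinuous_lscEnvelope _).measurable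
  have hgle : ∀ x ∈ Ω, g x ≤
      ENNReal.ofReal ((2 * Metric.infDist x (frontier Ω)) ^ β * (1 + ε)) := fun x hx =>
    (lscEnvelope_le _ x).trans (admissibleInf_le_infDist_rpow hΩ hne β ε hx)
  have hgt : ∀ x ∈ Ω, g x ≠ ⊤ := fun x hx => ((hgle x hx).trans_lt ENNReal.ofReal_lt_top).ne
  have hcont : Continuous fun x : EuclideanSpace ℝ (Fin d) =>
      (2 * Metric.infDist x (frontier Ω)) ^ β * (1 + ε) := by
    have h1 := Metric.continuous_infDist_pt (frontier Ω)
    exact ((continuous_const.mul h1).rpow_const fun x => Or.inr hβ.le).mul continuous_const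
  have hloc : LocallyIntegrableOn (fun x => (g x).toReal) Ω volume := by
    refine (locallyIntegrableOn_iff hΩ.isLocallyClosed).2 fun K hKΩ hK => ?_
    refine Integrable.mono' (hcont.continuousOn.integrableOn_compact hK)
      hgm.ennreal_toReal.aestronglyMeasurable ?_
    refine (ae_restrict_iff' hK.measurableSet).2 (Eventually.of_forall fun x hx => ?_)
    rw [Real.norm_eq_abs, abs_of_nonneg ENNReal.toReal_nonneg]
    refine ENNReal.toReal_le_of_le_ofReal ?_ (hgle x (hKΩ hx))
    have := Metric.infDist_nonneg (x := x) (s := frontier Ω)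
    positivity
  refine isSuperharmonicOn_of_integral_ball_le hd hΩ hloc fun K hKΩ hK => ?_
  obtain ⟨δ, hδ, hδK⟩ : ∃ δ : ℝ, 0 < δ ∧ ∀ x ∈ K, δ ≤ Metric.infDist x (frontier Ω) := by
    rcases K.eq_empty_or_nonempty with rfl | hKne
    · exact ⟨1, one_pos, by simp⟩
    · obtain ⟨x, hx, hmin⟩ := hK.exists_isMinOn hKne
        (Metric.continuous_infDist_pt (frontier Ω)).continuousOn
      exact ⟨_, infDist_frontier_pos hΩ hne (hKΩ hx), fun y hy => hmin hy⟩
  have hc : (0 : ℝ) < 8 * (d + 1) := by positivity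
  refine ⟨δ / (8 * (d + 1)), by positivity, fun x hx σ hσ hσδ => ?_⟩
  rw [lt_div_iff₀' hc] at hσδ
  have hσx := hσδ.trans_le (hδK x hx)
  have hσx' : σ < Metric.infDist x (frontier Ω) := by
    have : (0 : ℝ) ≤ d := Nat.cast_nonneg d
    nlinarith
  have hball : Metric.ball x σ ⊆ Ω := Metric.ball_subset_closedBall.trans
    (closedBall_subset_of_lt_infDist_frontier hΩ (hKΩ hx) hσx')
  have hle := setLIntegral_lscEnvelope_le_lscEnvelope hd hΩ hne hα hε hM hA hAε h (hKΩ hx) hσ hσx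
  rw [integral_toReal hgm.aemeasurable ((ae_restrict_iff' measurableSet_ball).2
    (Eventually.of_forall fun y hy => (hgt y (hball hy)).lt_top)), measureReal_def,
    ← Measure.addHaar_ball_center volume x σ, ← ENNReal.toReal_mul]
  exact ENNReal.toReal_mono (ENNReal.mul_ne_top measure_ball_lt_top.ne (hgt x (hKΩ hx))) hle

theorem theorem21p11p08p1 (α β M : ℝ) (hβ : 0 < β) (hβα : β < α) (hM : 0 < M) :
    ∃ N : ℝ, 0 < N ∧
      ∀ (d : ℕ), 2 ≤ d →
        ∀ Ω : Set (EuclideanSpace ℝ (Fin d)), IsOpen Ω → IsConnected Ω → Ω ≠ univ →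
          LHMDWith Ω α M →
            ∃ φ : EuclideanSpace ℝ (Fin d) → ℝ, IsSuperharmonicOn φ Ω ∧
              ∀ x ∈ Ω, N⁻¹ * Metric.infDist x (frontier Ω) ^ β ≤ φ x ∧
                φ x ≤ N * Metric.infDist x (frontier Ω) ^ β := by
  obtain ⟨A, hA, hAε⟩ := exists_radius_ratio (M := M) hβα
  have hA0 : 0 < A := by linarith
  set ε := A ^ (-β) / 2
  have hε : 0 < ε := by positivity
  have h2β : (0 : ℝ) < 2 ^ β := by positivity
  refine ⟨ε⁻¹ + 2 ^ β * (1 + ε), by positivity, fun d hd Ω hΩ hconn hΩne h => ?_⟩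
  have hne : (frontier Ω).Nonempty := nonempty_frontier_iff.2 ⟨hconn.nonempty, hΩne⟩
  have hα : 0 < α := hβ.trans hβα
  refine ⟨fun x => (lscEnvelope (admissibleInf Ω β ε) x).toReal,
    isSuperharmonicOn_lscEnvelope (by omega) hΩ hne hα hβ hε hM hA hAε h, fun x hx => ?_⟩
  set ρ := Metric.infDist x (frontier Ω) with hρ
  have hρ0 : 0 ≤ ρ := Metric.infDist_nonneg
  have hρβ : 0 ≤ ρ ^ β := Real.rpow_nonneg hρ0 β
  have hup : lscEnvelope (admissibleInf Ω β ε) x ≤ ENNReal.ofReal ((2 * ρ) ^ β * (1 + ε)) :=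
    (lscEnvelope_le _ x).trans (admissibleInf_le_infDist_rpow hΩ hne β ε hx)
  have hlow : ENNReal.ofReal (ε * ρ ^ β) ≤ lscEnvelope (admissibleInf Ω β ε) x := by
    have hc : Continuous fun y => ENNReal.ofReal (ε * Metric.infDist y (frontier Ω) ^ β) :=
      ENNReal.continuous_ofReal.comp (continuous_const.mul
        ((Metric.continuous_infDist_pt _).rpow_const fun x => Or.inr hβ.le))
    rw [hρ, lscEnvelope, ← (hc.tendsto x).liminf_eq]
    exact liminf_le_liminf (Eventually.of_forall fun y => le_admissibleInf hβ hε y)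
  constructor
  · rw [← ENNReal.ofReal_le_iff_le_toReal (hup.trans_lt ENNReal.ofReal_lt_top).ne]
    refine le_trans (ENNReal.ofReal_le_ofReal ?_) hlow
    refine mul_le_mul_of_nonneg_right ?_ hρβ
    rw [inv_le_comm₀ (by positivity) hε]
    exact le_add_of_nonneg_right (by positivity)
  · refine ENNReal.toReal_le_of_le_ofReal (by positivity) (hup.trans (ENNReal.ofReal_le_ofReal ?_))
    rw [Real.mul_rpow zero_le_two hρ0]
    have : 0 ≤ ε⁻¹ * ρ ^ β := by positivity
    linarith
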